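/- Let $q$ be a prime power, let $m\ge 2$, and let $\mathbb F_q\subseteq\mathbb F_{q^m}\subseteq\mathbb F_{q^{2m}}$. Let $\gamma$ be a primitive element of $\mathbb F_{q^{2m}}$ and put $\omega=\gamma^{q^m+1}$, a primitive element of $\mathbb F_{q^m}$. Let $N\ge 1$ divide $q^m-1$, and put $C_0^{(N,q^m)}=\langle\omega^N\rangle$ and $C_i^{(N,q^{2m})}=\gamma^i\langle\gamma^N\rangle$ for $0\le i\le N-1$. For an additive abelian group $G$ and $D\subseteq G$ with $0\notin D$ and $-D=D$, $\mathrm{Cay}(G,D)$ is the graph on $G$ in which two elements are adjacent if and only if their difference lies in $D$. Complete and edgeless graphs are not counted as strongly regular. Assume that $\mathbb F_q^*\le C_0^{(N,q^m)}$ and that $\mathrm{Cay}(\mathbb F_{q^m},C_0^{(N,q^m)})$ is strongly regular. In $\mathbb F_{q^m}^*/\mathbb F_q^*$ let $H_0$ be the set of all classes $x\mathbb F_q^*$ with $\mathrm{Tr}_{q^m/q}(x)=0$, let $\overline{C_0}=C_0^{(N,q^m)}/\mathbb F_q^*$, and let $\overline\omega=\omega\mathbb F_q^*$. Then there is a nonzero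 (necessarily unique) integer $\delta$ such that the set of values of $|H_0\cap\overline\omega^{\,i}\,\overline{C_0}|-|H_0\cap\overline{C_0}|$ for $0\le i\le N-1$ is exactly $\{0,\delta\}$. Moreover, put $$I=\{0\le i\le N-1 : |H_0\cap\overline\omega^{\,i}\,\overline{C_0}|-|H_0\cap\overline{C_0}|=\delta\},\qquad E=\bigcup_{i\in I}C_i^{(N,q^{2m})}.$$ Then $0\notin E$, $-E=E$, and $\mathrm{Cay}(\mathbb F_{q^{2m}},E)$ is a strongly regular graph with the negative Latin square type parameters $$(v,k,\lambda,\mu)=(n^2,\ r(n+1),\ -n+r^2+3r,\ r^2+r),\qquad n=q^m,\quad r=\frac{(q^m-1)|I|}{N}.$$ In particular, $r$ is an integer. -/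

import Mathlib

open scoped Pointwise

noncomputable section

/-- The cyclotomic class `g ^ i * ⟨g ^ N⟩` in a field, for a unit `g` (a primitive element in all
uses), as a set of field elements. For `i = 0` it is the subgroup of `N`-th powers. -/
def cyclotomicClass {K : Type*} [Field K] (g : Kˣ) (N i : ℕ) : Set K :=
  (fun u : Kˣ => (u : K)) '' ((g ^ i) • (Subgroup.zpowers (g ^ N) : Set Kˣ))

/-- `D` is a legitimate connection set of a Cayley graph on an additive group:
`0 ∉ D` and `-D = D`. -/
def IsConnectionSet {G : Type*} [AddGroup G] (D : Set G) : Prop :=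
  (0 : G) ∉ D ∧ -D = D

open Classical in
/-- `Γ` is a strongly regular graph with parameters `(v, k, l, μ)`. As usual, complete graphs and
edgeless graphs are not counted as strongly regular. -/
def IsStronglyRegular {V : Type*} [Fintype V] (Γ : SimpleGraph V) (v k l μ : ℕ) : Prop :=
  Γ.IsSRGWith v k l μ ∧ Γ ≠ ⊤ ∧ Γ ≠ ⊥

/-- `Γ` is strongly regular with the negative Latin square type parameters
`(n ^ 2, r (n + 1), -n + r ^ 2 + 3 r, r ^ 2 + r)`. -/
def IsNegativeLatinSquareSRG {V : Type*} [Fintype V] (Γ : SimpleGraph V) (n r : ℕ) : Prop :=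
  ∃ l : ℕ, (l : ℤ) = -(n : ℤ) + (r : ℤ) ^ 2 + 3 * (r : ℤ) ∧
    IsStronglyRegular Γ (n ^ 2) (r * (n + 1)) l (r ^ 2 + r)

/-- The multiplicative group of the subfield `F`, as a subgroup of the units of `K`. -/
def subfieldUnits (F K : Type*) [Field F] [Field K] [Algebra F K] : Subgroup Kˣ :=
  (Units.map (algebraMap F K : F →* K)).range

/-- The trace-zero hyperplane (Singer difference set) in the group `Kˣ / Fˣ` of projective points:
the classes of the units of `K` whose trace to `F` is zero. -/
def singerHyperplane (F K : Type*) [Field F] [Field K] [Algebra F K] : Set (Kˣ ⧸ subfieldUnits F K) :=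
  (fun x : Kˣ => (x : Kˣ ⧸ subfieldUnits F K)) '' {x : Kˣ | Algebra.trace F K (x : K) = 0}

/-- The image in `Kˣ / Fˣ` of the subgroup of `N`-th powers `⟨w ^ N⟩` of `Kˣ`. -/
def classImage (F : Type*) {K : Type*} [Field F] [Field K] [Algebra F K]
    (w : Kˣ) (N : ℕ) : Subgroup (Kˣ ⧸ subfieldUnits F K) :=
  (Subgroup.zpowers (w ^ N)).map (QuotientGroup.mk' (subfieldUnits F K))

/-- The number of points of the hyperplane lying in the `i`-th coset of `classImage F w N`. -/
def hyperplaneCount (F : Type*) {K : Type*} [Field F] [Field K] [Algebra F K]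
    (w : Kˣ) (N i : ℕ) : ℕ :=
  (singerHyperplane F K ∩
    ((QuotientGroup.mk' (subfieldUnits F K) w) ^ i •
      (classImage F w N : Set (Kˣ ⧸ subfieldUnits F K)))).ncard

/-- The difference of the intersection numbers of the hyperplane with the `i`-th coset and with the
`0`-th coset of `classImage F w N`. -/
def countDiff (F : Type*) {K : Type*} [Field F] [Field K] [Algebra F K]
    (w : Kˣ) (N i : ℕ) : ℤ :=
  (hyperplaneCount F w N i : ℤ) - (hyperplaneCount F w N 0 : ℤ)

/-- The set of the indices `0 ≤ i ≤ N - 1` whose intersection number differs from that of the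
`0`-th coset by exactly `δ`. When `δ` is the unique nonzero value of the difference, this is the
subdifference set. -/
def subdifferenceSet (F : Type*) {K : Type*} [Field F] [Field K] [Algebra F K]
    (w : Kˣ) (N : ℕ) (δ : ℤ) : Finset ℕ :=
  (Finset.range N).filter (fun i => countDiff F w N i = δ)

/-- The union of the cyclotomic classes with index in `I`. -/
def cyclotomicUnion {E : Type*} [Field E] (g : Eˣ) (N : ℕ) (I : Finset ℕ) : Set E :=
  ⋃ i ∈ I, cyclotomicClass g N i

end

/-!
Fix a nontrivial additive character `ψ` of `F` and transport it to `K` and `L` by the trace. The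
Gauss periods `η t = ∑ c ∈ ⟨ω ^ N⟩, ψ (Tr (c * t))`, for `t ≠ 0`, are the nontrivial eigenvalues of
the cyclotomic graph on `K`. Strong regularity makes them roots of one quadratic polynomial, and
they are not all equal because the graph is not complete (`charSum_sq_of_isStronglyRegular`,
`mem_iff_mem_of_charSum_eq`). Since `⟨ω ^ N⟩` contains `Fˣ`, averaging over scalars shows that
`η (ω ^ i) - η 1` is `q` times the difference of the intersection numbers of the hyperplane
(`charSum_powerFinset_sub`), so these differences take exactly the values `0` and some `δ ≠ 0`.

Let `D` be the set of the `t ≠ 0` with `η t ≠ η 1`. The norm of `γ` is `ω`, so the connection set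
`E` in `L` is `{x | N x ∈ D}`. The indicator function of `D` is affine in `η`, so the Fourier
transform of the indicator function of `E` reduces to sums `∑ x, ψ (c * N x + Tr (x * y))`.
The norm is an anisotropic binary quadratic form over `K`, and completing the square evaluates this
sum as `-|K| * ψ (-N y / c)` (`sum_char_norm_add_trace`). As `⟨ω ^ N⟩` is closed under negation and
inversion, summing over `c` gives back `η (N y)`: away from `0`, the Fourier transform of
the indicator function of `E` is `r - |K| • 1_E` with `r = |D|` (`charSum_normPreimage`).
The Cayley graph of `E` therefore has the two nontrivial eigenvalues `r` and `r - |K|`, and Fourier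
inversion yields its parameters (`isNegativeLatinSquareSRG_of_charSum`).
-/

open scoped Pointwise
open Finset

/-! ### Fourier analysis on a finite field -/

/-- The Fourier transform `y ↦ ∑ x ∈ S, ψ (x * y)` of the indicator function of a finite subset `S`
of `K` with respect to an additive character `ψ`. -/
noncomputable def charSum {K : Type*} [Field K] (ψ : AddChar K ℂ) (S : Finset K) (y : K) : ℂ :=
  ∑ x ∈ S, ψ (x * y)

lemma charSum_zero {K : Type*} [Field K] (ψ : AddChar K ℂ) (S : Finset K) :
    charSum ψ S 0 = #S := by
  simp [charSum]

section Fourier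

variable {K : Type*} [Field K] [Fintype K] {ψ : AddChar K ℂ}

lemma sum_char_mul_eq_zero (hψ : ψ.IsPrimitive) {b : K} (hb : b ≠ 0) :
    ∑ x : K, ψ (x * b) = 0 := by
  classical
  simpa [hb] using AddChar.sum_mulShift b hψ

lemma fourier_inversion (hψ : ψ.IsPrimitive) (f : K → ℂ) (z : K) :
    ∑ y, (∑ x, f x * ψ (x * y)) * ψ (-(z * y)) = Fintype.card K * f z := by
  classical
  calc ∑ y, (∑ x, f x * ψ (x * y)) * ψ (-(z * y))
      = ∑ x, f x * ∑ y, ψ (y * (x - z)) := by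
        simp_rw [sum_mul, mul_sum]
        rw [sum_comm]
        refine sum_congr rfl fun x _ => sum_congr rfl fun y _ => ?_
        rw [mul_assoc, ← AddChar.map_add_eq_mul]
        congr 2
        ring
    _ = ∑ x, if x = z then f x * Fintype.card K else 0 := by
        refine sum_congr rfl fun x _ => ?_
        rw [AddChar.sum_mulShift _ hψ]
        simp only [sub_eq_zero]
        split_ifs <;> simp
    _ = Fintype.card K * f z := by
        simp [mul_comm]

/-- A function whose Fourier transform vanishes away from `0` is constant. -/
lemma eq_of_fourier_eq_zero (hψ : ψ.IsPrimitive) (f : K → ℂ)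
    (hf : ∀ y ≠ 0, ∑ x, f x * ψ (x * y) = 0) (z z' : K) : f z = f z' := by
  have key : ∀ z, Fintype.card K * f z = ∑ x, f x := fun z => by
    rw [← fourier_inversion hψ f z, sum_eq_single 0]
    · simp
    · intro y _ hy
      rw [hf y hy, zero_mul]
    · simp
  have h0 : (Fintype.card K : ℂ) ≠ 0 := by exact_mod_cast Fintype.card_ne_zero
  exact mul_left_cancel₀ h0 ((key z).trans (key z').symm)

/-- A set whose Fourier coefficients away from `0` are all equal contains either all the nonzero
elements or none of them. -/
lemma mem_iff_mem_of_charSum_eq (hψ : ψ.IsPrimitive) (S : Finset K) (a : ℂ)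
    (hS : ∀ y ≠ 0, charSum ψ S y = a) {z z' : K} (hz : z ≠ 0) (hz' : z' ≠ 0) :
    z ∈ S ↔ z' ∈ S := by
  classical
  have := eq_of_fourier_eq_zero hψ
    (fun x => (if x ∈ S then 1 else 0) - if x = 0 then a else 0) (fun y hy => by
      simpa [sub_mul, sum_sub_distrib, ite_mul, charSum, sub_eq_zero] using hS y hy) z z'
  by_cases h : z ∈ S <;> by_cases h' : z' ∈ S <;> simp_all

/-! ### Cayley graphs and their spectra -/

open Classical in
/-- The number of representations of `z` as a difference of two elements of `S`. -/
noncomputable def diffCount {G : Type*} [AddGroup G] (S : Finset G) (z : G) : ℕ :=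
  #{a ∈ S | a + z ∈ S}

lemma sum_diffCount_mul_char (ψ : AddChar K ℂ) {S : Finset K} (hS : ∀ x ∈ S, -x ∈ S) (y : K) :
    ∑ z, (diffCount S z : ℂ) * ψ (z * y) = charSum ψ S y ^ 2 := by
  classical
  have hneg : charSum ψ S y = ∑ a ∈ S, ψ (-a * y) :=
    sum_nbij' (fun x => -x) (fun x => -x) hS hS (by simp) (by simp) (by simp)
  calc ∑ z, (diffCount S z : ℂ) * ψ (z * y)
      = ∑ z, ∑ a ∈ S, if a + z ∈ S then ψ (z * y) else 0 := by
        refine sum_congr rfl fun z _ => ?_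
        rw [diffCount, card_filter]
        push_cast
        rw [sum_mul]
        simp
    _ = ∑ a ∈ S, ∑ z, if a + z ∈ S then ψ (z * y) else 0 := sum_comm
    _ = ∑ a ∈ S, ψ (-a * y) * charSum ψ S y := by
        refine sum_congr rfl fun a _ => ?_
        rw [← Equiv.sum_comp (Equiv.subRight a)]
        simp only [Equiv.subRight_apply, add_sub_cancel, sum_ite_mem, univ_inter, charSum, mul_sum]
        refine sum_congr rfl fun b _ => ?_
        rw [← AddChar.map_add_eq_mul]
        congr 1
        ring
    _ = charSum ψ S y ^ 2 := by rw [← sum_mul, ← hneg, sq]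

end Fourier

section Cayley

variable {G : Type*} [AddCommGroup G]

lemma addCayley_adj_iff {S : Set G} (h : IsConnectionSet S) (u v : G) :
    (SimpleGraph.addCayley S).Adj u v ↔ v - u ∈ S := by
  have hneg : ∀ {x}, x ∈ S → -x ∈ S := fun {x} hx => by
    rw [← h.2]
    simpa using hx
  rw [SimpleGraph.addCayley_adj']
  constructor
  · rintro ⟨-, g, hg, rfl | rfl⟩
    · simpa using hg
    · simpa using hneg hg
  · intro hS
    refine ⟨?_, v - u, hS, Or.inl (by abel)⟩
    rintro rfl
    exact h.1 (by simpa using hS)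

open Classical in
lemma degree_addCayley [Fintype G] {S : Finset G} (h : IsConnectionSet (S : Set G)) (v : G) :
    (SimpleGraph.addCayley (S : Set G)).degree v = #S := by
  rw [← SimpleGraph.card_neighborFinset_eq_degree]
  refine card_nbij' (fun x => x - v) (fun x => x + v) ?_ ?_ ?_ ?_ <;> intro x <;>
    simp [addCayley_adj_iff h]

open Classical in
lemma card_commonNeighbors_addCayley [Fintype G] {S : Finset G}
    (h : IsConnectionSet (S : Set G)) (v w : G) :
    Fintype.card ((SimpleGraph.addCayley (S : Set G)).commonNeighbors v w)
      = diffCount S (v - w) := by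
  rw [← Set.toFinset_card, diffCount]
  refine card_nbij' (fun x => x - v) (fun x => x + v) ?_ ?_ ?_ ?_ <;> intro x <;>
    simp +contextual [addCayley_adj_iff h, SimpleGraph.mem_commonNeighbors, add_sub_assoc]

open Classical in
lemma isSRGWith_addCayley_iff [Fintype G] {S : Finset G} (h : IsConnectionSet (S : Set G))
    (v k l μ : ℕ) :
    (SimpleGraph.addCayley (S : Set G)).IsSRGWith v k l μ ↔
      Fintype.card G = v ∧ #S = k ∧ (∀ z ∈ S, diffCount S z = l) ∧
        ∀ z ≠ 0, z ∉ S → diffCount S z = μ := by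
  have hneg : ∀ {x}, x ∈ S ↔ -x ∈ S := fun {x} => by
    have := congrArg (x ∈ ·) h.2
    simpa using this.symm
  constructor
  · intro H
    refine ⟨H.card, ?_, fun z hz => ?_, fun z hz hzS => ?_⟩
    · rw [← degree_addCayley h 0, H.regular]
    · rw [← H.of_adj z 0 ((addCayley_adj_iff h _ _).2 (by simpa using hneg.1 hz)),
        card_commonNeighbors_addCayley h, sub_zero]
    · rw [← H.of_not_adj hz (by rw [addCayley_adj_iff h]; simpa [← hneg] using hzS),
        card_commonNeighbors_addCayley h, sub_zero]
  · rintro ⟨hv, hk, hl, hμ⟩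
    refine ⟨hv, fun x => by convert (degree_addCayley h x).trans hk, fun x y hxy => ?_,
      fun x y hne hxy => ?_⟩
    · rw [card_commonNeighbors_addCayley h]
      rw [addCayley_adj_iff h] at hxy
      exact hl _ (by simpa using hneg.1 hxy)
    · rw [card_commonNeighbors_addCayley h]
      rw [addCayley_adj_iff h] at hxy
      exact hμ _ (sub_ne_zero.2 hne) fun hS => hxy (by simpa using hneg.1 hS)

lemma diffCount_zero (S : Finset G) : diffCount S 0 = #S := by
  classical
  rw [diffCount, filter_true_of_mem]
  simp

variable {K : Type*} [Field K] [Fintype K] {ψ : AddChar K ℂ}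

/-- The eigenvalues of a strongly regular Cayley graph at nontrivial characters are roots of a
fixed quadratic polynomial. -/
lemma charSum_sq_of_isStronglyRegular (hψ : ψ.IsPrimitive) {S : Finset K}
    (h : IsConnectionSet (S : Set K)) {v k l μ : ℕ}
    (hS : IsStronglyRegular (SimpleGraph.addCayley (S : Set K)) v k l μ) {y : K} (hy : y ≠ 0) :
    charSum ψ S y ^ 2 = (k - μ : ℂ) + (l - μ) * charSum ψ S y := by
  classical
  have H := (isSRGWith_addCayley_iff h v k l μ).1 (by convert hS.1)
  obtain ⟨-, hk, hl, hμ⟩ := H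
  have hneg : ∀ x ∈ S, -x ∈ S := fun x hx => by
    have := congrArg (x ∈ ·) h.2
    simpa using this.symm.mp hx
  have h0 : (0 : K) ∉ S := fun h' => h.1 h'
  rw [← sum_diffCount_mul_char ψ hneg]
  have : ∀ z, (diffCount S z : ℂ) = (if z = 0 then (k - μ : ℂ) else 0)
      + (l - μ) * (if z ∈ S then 1 else 0) + μ := by
    intro z
    by_cases hz : z = 0
    · subst hz
      simp [diffCount_zero, hk, h0]
    · by_cases hzS : z ∈ S
      · simp [hz, hzS, hl z hzS]
      · simp [hz, hzS, hμ z hz hzS]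
  simp_rw [this, add_mul, sum_add_distrib, mul_assoc, ← mul_sum, sum_char_mul_eq_zero hψ hy]
  simp [charSum]

/-- A Cayley graph whose connection set `S` is self-dual, in the sense that the Fourier transform
of its indicator function is `r - n • 1_S` away from `0`, is strongly regular of negative Latin
square type. -/
lemma isNegativeLatinSquareSRG_of_charSum (hψ : ψ.IsPrimitive) {S : Finset K}
    (h : IsConnectionSet (S : Set K)) {n r : ℕ} (hn : Fintype.card K = n ^ 2)
    (hcard : #S = r * (n + 1)) (hne : S.Nonempty) {e : K} (he : e ≠ 0) (heS : e ∉ S)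
    (hin : ∀ y ∈ S, charSum ψ S y = r - n) (hout : ∀ y ≠ 0, y ∉ S → charSum ψ S y = r) :
    IsNegativeLatinSquareSRG (SimpleGraph.addCayley (S : Set K)) n r := by
  classical
  have hneg : ∀ x ∈ S, -x ∈ S := fun x hx => by
    have := congrArg (x ∈ ·) h.2
    simpa using this.symm.mp hx
  have h0 : (0 : K) ∉ S := fun h' => h.1 h'
  -- the two eigenvalues `r` and `r - n` are the roots of `X ^ 2 - (2 * r - n) * X + r * (r - n)`
  have key := eq_of_fourier_eq_zero hψ (fun z => (diffCount S z : ℂ)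
      - (2 * r - n) * (if z ∈ S then 1 else 0) + (if z = 0 then (r * (r - n) : ℂ) else 0))
      (fun y hy => by
    simp_rw [add_mul, sub_mul, mul_assoc, sum_add_distrib, sum_sub_distrib]
    rw [sum_diffCount_mul_char ψ hneg]
    have hχ : charSum ψ S y = r ∨ charSum ψ S y = r - n := by
      by_cases hyS : y ∈ S
      · exact Or.inr (hin y hyS)
      · exact Or.inl (hout y hy hyS)
    have e1 : ∑ x, (2 * (r : ℂ)) * ((if x ∈ S then 1 else 0) * ψ (x * y))
        = 2 * r * charSum ψ S y := by
      simp [← mul_sum, charSum]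
    have e2 : ∑ x, (n : ℂ) * ((if x ∈ S then 1 else 0) * ψ (x * y))
        = n * charSum ψ S y := by
      simp [← mul_sum, charSum]
    simp only [← mul_assoc, ite_mul, zero_mul, sum_ite_eq', mem_univ, if_true,
      AddChar.map_zero_eq_one, mul_one] at e1 e2 ⊢
    simp only [mul_ite, mul_zero, one_mul] at e1 e2 ⊢
    rw [e1, e2]
    rcases hχ with hχ | hχ <;> rw [hχ] <;> ring)
  have hcount : ∀ z ≠ 0, (diffCount S z : ℤ)
      = r ^ 2 + r + (2 * r - n) * (if z ∈ S then 1 else 0) := fun z hz => by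
    have h1 := key z 0
    simp only [hz, h0, diffCount_zero, hcard, if_false, if_true] at h1
    push_cast at h1
    have h2 : (diffCount S z : ℂ) = r ^ 2 + r + (2 * r - n) * (if z ∈ S then 1 else 0) := by
      linear_combination h1
    have h3 : ((diffCount S z : ℤ) : ℂ)
        = ((r ^ 2 + r + (2 * r - n) * (if z ∈ S then 1 else 0) : ℤ) : ℂ) := by
      push_cast
      exact h2
    exact_mod_cast h3
  obtain ⟨s, hs⟩ := hne
  have hs0 : s ≠ 0 := fun h' => h0 (h' ▸ hs)
  have hl : ∀ z ∈ S, (diffCount S z : ℤ) = -(n : ℤ) + (r : ℤ) ^ 2 + 3 * (r : ℤ) := fun z hz => by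
    rw [hcount z fun h' => h0 (h' ▸ hz), if_pos hz]
    ring
  refine ⟨diffCount S s, hl s hs, ?_, ?_, ?_⟩
  · convert (isSRGWith_addCayley_iff h _ _ _ _).2 ⟨hn, hcard, fun z hz => ?_, fun z hz hzS => ?_⟩
    · exact_mod_cast (hl z hz).trans (hl s hs).symm
    · have := hcount z hz
      rw [if_neg hzS] at this
      push_cast [← @Nat.cast_inj ℤ]
      linarith
  · intro htop
    have : (SimpleGraph.addCayley (S : Set K)).Adj 0 e := by
      rw [htop]
      exact he.symm
    rw [addCayley_adj_iff h] at this
    exact heS (by simpa using this)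
  · intro hbot
    have : (SimpleGraph.addCayley (S : Set K)).Adj 0 s :=
      (addCayley_adj_iff h _ _).2 (by simpa using hs)
    rw [hbot] at this
    exact this

end Cayley

/-! ### The norm form of a quadratic extension -/

section Quadratic

variable {K L : Type*} [Field K] [Fintype K] [Field L] [Fintype L] [Algebra K L]

lemma card_eq_sq_of_finrank_eq_two (hL : Module.finrank K L = 2) :
    Fintype.card L = Fintype.card K ^ 2 := by
  rw [← hL, Module.card_eq_pow_finrank (K := K)]

lemma algebraMap_norm_of_finrank_eq_two (hL : Module.finrank K L = 2) (x : L) :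
    algebraMap K L (Algebra.norm K x) = x * x ^ Fintype.card K := by
  rw [FiniteField.algebraMap_norm_eq_prod_pow, hL]
  simp [prod_range_succ]

lemma algebraMap_trace_of_finrank_eq_two (hL : Module.finrank K L = 2) (x : L) :
    algebraMap K L (Algebra.trace K L x) = x + x ^ Fintype.card K := by
  rw [FiniteField.algebraMap_trace_eq_sum_pow, hL]
  simp [sum_range_succ]

/-- The polar form of the norm of a quadratic extension is the trace form twisted by Frobenius. -/
lemma norm_add_of_finrank_eq_two (hL : Module.finrank K L = 2) (x a : L) :
    Algebra.norm K (x + a)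
      = Algebra.norm K x + Algebra.trace K L (x * a ^ Fintype.card K) + Algebra.norm K a := by
  have hfrob : (a ^ Fintype.card K) ^ Fintype.card K = a := by
    rw [← pow_mul, ← sq, ← card_eq_sq_of_finrank_eq_two hL, FiniteField.pow_card]
  have hadd : (x + a) ^ Fintype.card K = x ^ Fintype.card K + a ^ Fintype.card K :=
    map_add (FiniteField.frobeniusAlgHom K L) x a
  apply (algebraMap K L).injective
  simp only [map_add, algebraMap_norm_of_finrank_eq_two hL, algebraMap_trace_of_finrank_eq_two hL,
    mul_pow, hfrob, hadd]
  ring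

omit [Fintype K] in
open Classical in
lemma card_norm_fiber_zero : #{x : L | Algebra.norm K x = 0} = 1 := by
  rw [card_eq_one]
  exact ⟨0, by ext; simp⟩

open Classical in
lemma card_norm_fiber (hL : Module.finrank K L = 2) {t : K} (ht : t ≠ 0) :
    #{x : L | Algebra.norm K x = t} = Fintype.card K + 1 := by
  -- all fibres over nonzero elements have the same size
  have hconst : ∀ s : K, s ≠ 0 →
      #{x : L | Algebra.norm K x = s} = #{x : L | Algebra.norm K x = t} := fun s hs => by
    obtain ⟨z, hz⟩ := FiniteField.norm_surjective K L (t / s)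
    have hz0 : z ≠ 0 := by
      rintro rfl
      rw [Algebra.norm_zero] at hz
      exact div_ne_zero ht hs hz.symm
    have hzi : Algebra.norm K z⁻¹ = s / t := by
      have h1 : Algebra.norm K z⁻¹ * Algebra.norm K z = 1 := by
        rw [← map_mul, inv_mul_cancel₀ hz0, map_one]
      rw [hz] at h1
      rw [eq_inv_of_mul_eq_one_left h1, inv_div]
    refine card_nbij' (fun x => x * z) (fun x => x * z⁻¹) ?_ ?_ ?_ ?_ <;> intro x
    · simp only [coe_filter, mem_univ, true_and, Set.mem_ofPred_eq, map_mul, hz]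
      rintro rfl
      field_simp
    · simp only [coe_filter, mem_univ, true_and, Set.mem_ofPred_eq, map_mul, hzi]
      rintro rfl
      field_simp
    · simp [hz0]
    · simp [hz0]
  have htot : Fintype.card L = ∑ s : K, #{x : L | Algebra.norm K x = s} := by
    rw [← card_univ]
    exact card_eq_sum_card_fiberwise fun _ _ => mem_coe.2 (mem_univ _)
  rw [← add_sum_erase _ _ (mem_univ (0 : K)), card_norm_fiber_zero,
    sum_congr rfl fun s hs => hconst s (ne_of_mem_erase hs), sum_const,
    card_erase_of_mem (mem_univ _), card_univ, card_eq_sq_of_finrank_eq_two hL, smul_eq_mul] at htot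
  have h1 : 1 < Fintype.card K := Fintype.one_lt_card
  obtain ⟨k, hk⟩ : ∃ k, Fintype.card K = k + 2 := ⟨Fintype.card K - 2, by omega⟩
  rw [hk] at htot ⊢
  have : (k + 1) * #{x : L | Algebra.norm K x = t} = (k + 1) * (k + 3) := by
    have e : k + 2 - 1 = k + 1 := by omega
    rw [e] at htot
    linarith
  exact Nat.eq_of_mul_eq_mul_left (Nat.succ_pos k) this

lemma sum_comp_norm (hL : Module.finrank K L = 2) (f : K → ℂ) :
    ∑ x : L, f (Algebra.norm K x)
      = (Fintype.card K + 1) * ∑ t, f t - Fintype.card K * f 0 := by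
  classical
  rw [← sum_fiberwise_of_maps_to (s := univ) (t := univ) (g := fun x : L => Algebra.norm K x)
    (fun _ _ => mem_univ _)]
  have : ∀ t : K, ∑ x : L with Algebra.norm K x = t, f (Algebra.norm K x)
      = (Fintype.card K + 1) * f t - if t = 0 then Fintype.card K * f 0 else 0 := fun t => by
    rw [sum_congr rfl fun x hx => by rw [(mem_filter.1 hx).2], sum_const]
    by_cases ht : t = 0
    · subst ht
      rw [card_norm_fiber_zero]
      simp
      ring
    · rw [card_norm_fiber hL ht]
      simp [ht]
  rw [sum_congr rfl fun t _ => this t, sum_sub_distrib, ← mul_sum]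
  simp

/-- The Gauss sum of the norm form, an anisotropic binary quadratic form: completing the square
reduces it to the sum over the whole plane, which is `-|K|` because every nonzero value of the norm
is taken `|K| + 1` times. -/
lemma sum_char_norm_add_trace {ψ : AddChar K ℂ} (hψ : ψ.IsPrimitive)
    (hL : Module.finrank K L = 2) {c : K} (hc : c ≠ 0) (y : L) :
    ∑ x : L, ψ (Algebra.norm K x * c + Algebra.trace K L (x * y))
      = -(Fintype.card K : ℂ) * ψ (-(c⁻¹ * Algebra.norm K y)) := by
  have hcard := card_eq_sq_of_finrank_eq_two hL
  have hfrob : (y ^ Fintype.card K) ^ Fintype.card K = y := by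
    rw [← pow_mul, ← sq, ← hcard, FiniteField.pow_card]
  have hN : Algebra.norm K (y ^ Fintype.card K) = Algebra.norm K y := by
    rw [map_pow, FiniteField.pow_card]
  -- the centre of the completed square
  set a : L := c⁻¹ • y ^ Fintype.card K with ha
  have hsq : ∀ x : L, Algebra.norm K x * c + Algebra.trace K L (x * y)
      = Algebra.norm K (x + a) * c + -(c⁻¹ * Algebra.norm K y) := fun x => by
    have e1 : x * a ^ Fintype.card K = c⁻¹ • (x * y) := by
      rw [ha, smul_pow, FiniteField.pow_card, hfrob, mul_smul_comm]
    have e2 : Algebra.norm K a = c⁻¹ ^ 2 * Algebra.norm K y := by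
      rw [ha, Algebra.smul_def, map_mul, Algebra.norm_algebraMap, hL, hN]
    rw [norm_add_of_finrank_eq_two hL, e1, e2, map_smul, smul_eq_mul]
    field_simp
    ring
  simp_rw [hsq, AddChar.map_add_eq_mul]
  have hshift : ∑ x : L, ψ (Algebra.norm K (x + a) * c) = ∑ x : L, ψ (Algebra.norm K x * c) :=
    Equiv.sum_comp (Equiv.addRight a) fun x => ψ (Algebra.norm K x * c)
  rw [← sum_mul, hshift, sum_comp_norm hL fun t => ψ (t * c), sum_char_mul_eq_zero hψ hc]
  simp

variable {ψ : AddChar K ℂ}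

/-- The additive character `ψ ∘ Tr` of an extension `L` of `K`. -/
noncomputable def traceChar (L : Type*) [Field L] [Algebra K L] (ψ : AddChar K ℂ) : AddChar L ℂ :=
  ψ.compAddMonoidHom (Algebra.trace K L).toAddMonoidHom

omit [Fintype K] [Fintype L] in
lemma traceChar_apply (x : L) : traceChar L ψ x = ψ (Algebra.trace K L x) := rfl

lemma isPrimitive_traceChar (hψ : ψ.IsPrimitive) : (traceChar L ψ).IsPrimitive := by
  have : FiniteDimensional K L := Module.Finite.of_finite
  have h1 := hψ one_ne_zero
  rw [AddChar.mulShift_one, AddChar.ne_one_iff] at h1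
  obtain ⟨b, hb⟩ := h1
  obtain ⟨x, rfl⟩ := Algebra.trace_surjective K L b
  exact AddChar.IsPrimitive.of_ne_one (AddChar.ne_one_iff.2 ⟨x, hb⟩)

open Classical in
/-- The elements of `L` whose norm to `K` lies in `D`. -/
noncomputable def normPreimage (L : Type*) [Field L] [Fintype L] [Algebra K L] (D : Finset K) :
    Finset L :=
  {x | Algebra.norm K x ∈ D}

omit [Fintype K] in
lemma mem_normPreimage {D : Finset K} {x : L} : x ∈ normPreimage L D ↔ Algebra.norm K x ∈ D := by
  simp [normPreimage]

lemma card_normPreimage (hL : Module.finrank K L = 2) {D : Finset K} (hD : 0 ∉ D) :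
    #(normPreimage L D) = #D * (Fintype.card K + 1) := by
  classical
  have := sum_comp_norm hL (fun t => if t ∈ D then 1 else 0)
  simp only [hD, sum_ite_mem, univ_inter, sum_boole, if_false, mul_zero, sub_zero, sum_const,
    nsmul_eq_mul, mul_one] at this
  rw [normPreimage, mul_comm]
  exact_mod_cast this

omit [Fintype K] in
lemma isConnectionSet_normPreimage (hL : Module.finrank K L = 2) {D : Finset K} (hD : 0 ∉ D) :
    IsConnectionSet (normPreimage L D : Set L) := by
  refine ⟨by simpa [mem_normPreimage] using hD, ?_⟩
  ext x
  have : Algebra.norm K (-x) = Algebra.norm K x := by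
    rw [← neg_one_smul K x, Algebra.smul_def, map_mul, Algebra.norm_algebraMap, hL]
    simp
  simp [mem_normPreimage, this]

open Classical in
/-- If the indicator function of `D` is an affine function of the Fourier transform of `C`, a set
closed under negation and inversion, then `{x | N x ∈ D}` is self-dual. -/
lemma charSum_normPreimage (hψ : ψ.IsPrimitive) (hL : Module.finrank K L = 2) {C D : Finset K}
    (hC0 : 0 ∉ C) (hneg : ∀ c ∈ C, -c ∈ C) (hinv : ∀ c ∈ C, c⁻¹ ∈ C) (hD0 : 0 ∉ D) {a κ : ℂ}
    (hκ : κ ≠ 0) (hin : ∀ t ∈ D, charSum ψ C t = a + κ)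
    (hout : ∀ t ≠ 0, t ∉ D → charSum ψ C t = a) {y : L} (hy : y ≠ 0) :
    charSum (traceChar L ψ) (normPreimage L D) y
      = #D - Fintype.card K * if y ∈ normPreimage L D then 1 else 0 := by
  classical
  have hind : ∀ t, κ * (if t ∈ D then 1 else 0)
      = (charSum ψ C t - a) - if t = 0 then (#C - a : ℂ) else 0 := fun t => by
    by_cases ht : t = 0
    · subst ht
      simp [hD0, charSum_zero]
    · by_cases htD : t ∈ D
      · simp [ht, htD, hin t htD]
      · simp [ht, htD, hout t ht htD]
  have hr : κ * #D = -(Fintype.card K * a) - #C + a := by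
    have h1 : κ * #D = ∑ t, κ * (if t ∈ D then 1 else 0) := by simp [mul_comm]
    have h2 : ∑ t, charSum ψ C t = 0 := by
      simp only [charSum]
      rw [sum_comm]
      refine sum_eq_zero fun c hc => ?_
      simp_rw [mul_comm c]
      exact sum_char_mul_eq_zero hψ fun h => hC0 (h ▸ hc)
    rw [h1, sum_congr rfl fun t _ => hind t, sum_sub_distrib, sum_sub_distrib, h2]
    simp
    ring
  have hflip : ∑ c ∈ C, ψ (-(c⁻¹ * Algebra.norm K y)) = charSum ψ C (Algebra.norm K y) := by
    refine sum_nbij' (fun c => -c⁻¹) (fun c => -c⁻¹) (fun c hc => hneg _ (hinv c hc))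
      (fun c hc => hneg _ (hinv c hc)) ?_ ?_ ?_ <;> intro c _ <;> simp [inv_neg]
  have hG : ∑ x : L, charSum ψ C (Algebra.norm K x) * traceChar L ψ (x * y)
      = -Fintype.card K * charSum ψ C (Algebra.norm K y) := by
    simp only [charSum, sum_mul, traceChar_apply, ← AddChar.map_add_eq_mul]
    rw [sum_comm, sum_congr rfl fun c hc => ?_, ← mul_sum, hflip]
    · rfl
    · simp_rw [mul_comm c]
      exact sum_char_norm_add_trace hψ hL (fun h => hC0 (h ▸ hc)) y
  have hE : κ * charSum (traceChar L ψ) (normPreimage L D) y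
      = -Fintype.card K * charSum ψ C (Algebra.norm K y) - (#C - a) := by
    have h1 : κ * charSum (traceChar L ψ) (normPreimage L D) y
        = ∑ x : L, κ * (if Algebra.norm K x ∈ D then 1 else 0) * traceChar L ψ (x * y) := by
      simp [charSum, normPreimage, mul_sum, sum_filter]
    rw [h1]
    simp_rw [hind, sub_mul, sum_sub_distrib]
    rw [hG, ← mul_sum, sum_char_mul_eq_zero (isPrimitive_traceChar hψ) hy]
    simp
  have hNy := hind (Algebra.norm K y)
  rw [if_neg (Algebra.norm_ne_zero_iff.2 hy)] at hNy
  simp only [mem_normPreimage]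
  apply mul_left_cancel₀ hκ
  linear_combination hE - hr + (Fintype.card K : ℂ) * hNy

/-- A two-valued Fourier transform on `K` lifts along the norm of a quadratic extension to a
strongly regular graph of negative Latin square type. -/
theorem isNegativeLatinSquareSRG_normPreimage (hψ : ψ.IsPrimitive)
    (hL : Module.finrank K L = 2) {C D : Finset K} (hC0 : 0 ∉ C) (hneg : ∀ c ∈ C, -c ∈ C)
    (hinv : ∀ c ∈ C, c⁻¹ ∈ C) (hD0 : 0 ∉ D) {a κ : ℂ} (hκ : κ ≠ 0)
    (hin : ∀ t ∈ D, charSum ψ C t = a + κ) (hout : ∀ t ≠ 0, t ∉ D → charSum ψ C t = a)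
    (hD : D.Nonempty) (hD1 : 1 ∉ D) :
    IsNegativeLatinSquareSRG (SimpleGraph.addCayley (normPreimage L D : Set L))
      (Fintype.card K) #D := by
  classical
  refine isNegativeLatinSquareSRG_of_charSum (isPrimitive_traceChar hψ)
    (isConnectionSet_normPreimage hL hD0) (card_eq_sq_of_finrank_eq_two hL)
    (card_normPreimage hL hD0) ?_ one_ne_zero (by simpa [mem_normPreimage] using hD1) ?_ ?_
  · obtain ⟨t, ht⟩ := hD
    obtain ⟨x, rfl⟩ := FiniteField.norm_surjective K L t
    exact ⟨x, mem_normPreimage.2 ht⟩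
  · intro y hy
    rw [charSum_normPreimage hψ hL hC0 hneg hinv hD0 hκ hin hout, if_pos hy, mul_one]
    rintro rfl
    exact hD0 (by simpa [mem_normPreimage] using hy)
  · intro y hy hyE
    rw [charSum_normPreimage hψ hL hC0 hneg hinv hD0 hκ hin hout hy, if_neg hyE, mul_zero,
      sub_zero]

end Quadratic

/-! ### Cyclotomic classes and Gauss periods -/

section Cyclotomic

lemma mem_cyclotomicClass {K : Type*} [Field K] {g : Kˣ} {N i : ℕ} {x : K} :
    x ∈ cyclotomicClass g N i ↔ ∃ j : ℤ, x = ((g ^ ((i : ℤ) + N * j) : Kˣ) : K) := by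
  simp only [cyclotomicClass, Set.mem_image, Set.mem_smul_set, SetLike.mem_coe,
    Subgroup.mem_zpowers_iff, smul_eq_mul]
  constructor
  · rintro ⟨_, ⟨_, ⟨j, rfl⟩, rfl⟩, rfl⟩
    exact ⟨j, by rw [zpow_add, zpow_mul, zpow_natCast, zpow_natCast]⟩
  · rintro ⟨j, rfl⟩
    exact ⟨_, ⟨_, ⟨j, rfl⟩, rfl⟩, by rw [zpow_add, zpow_mul, zpow_natCast, zpow_natCast]⟩

variable {K : Type*} [Field K] [Fintype K]

open Classical in
/-- The subgroup of `N`-th powers `⟨w ^ N⟩` as a finite set of field elements. -/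
noncomputable def powerFinset (w : Kˣ) (N : ℕ) : Finset K :=
  {x | x ∈ cyclotomicClass w N 0}

variable {w : Kˣ} {N : ℕ}

lemma mem_powerFinset {x : K} :
    x ∈ powerFinset w N ↔ ∃ j : ℤ, x = ((w ^ ((N : ℤ) * j) : Kˣ) : K) := by
  simp [powerFinset, mem_cyclotomicClass]

lemma coe_powerFinset : (powerFinset w N : Set K) = cyclotomicClass w N 0 := by
  simp [powerFinset]

lemma zpow_mem_powerFinset (j : ℤ) : ((w ^ ((N : ℤ) * j) : Kˣ) : K) ∈ powerFinset w N :=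
  mem_powerFinset.2 ⟨j, rfl⟩

lemma one_mem_powerFinset : (1 : K) ∈ powerFinset w N :=
  mem_powerFinset.2 ⟨0, by simp⟩

lemma zero_notMem_powerFinset : (0 : K) ∉ powerFinset w N := by
  rw [mem_powerFinset]
  rintro ⟨j, hj⟩
  exact Units.ne_zero _ hj.symm

lemma mul_mem_powerFinset {x y : K} (hx : x ∈ powerFinset w N) (hy : y ∈ powerFinset w N) :
    x * y ∈ powerFinset w N := by
  obtain ⟨i, rfl⟩ := mem_powerFinset.1 hx
  obtain ⟨j, rfl⟩ := mem_powerFinset.1 hy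
  exact mem_powerFinset.2 ⟨i + j, by rw [mul_add, zpow_add, Units.val_mul]⟩

lemma inv_mem_powerFinset {x : K} (hx : x ∈ powerFinset w N) : x⁻¹ ∈ powerFinset w N := by
  obtain ⟨i, rfl⟩ := mem_powerFinset.1 hx
  exact mem_powerFinset.2 ⟨-i, by rw [mul_neg, zpow_neg, Units.val_inv_eq_inv_val]⟩

lemma isConnectionSet_powerFinset (h : (-1 : K) ∈ powerFinset w N) :
    IsConnectionSet (powerFinset w N : Set K) := by
  refine ⟨zero_notMem_powerFinset, ?_⟩
  have : ∀ x ∈ powerFinset w N, -x ∈ powerFinset w N := fun x hx => by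
    simpa using mul_mem_powerFinset h hx
  ext x
  exact ⟨fun hx => by simpa using this _ hx, fun hx => this _ hx⟩

/-- Gauss periods depend only on the cyclotomic class. -/
lemma charSum_powerFinset_mul (ψ : AddChar K ℂ) {c : K} (hc : c ∈ powerFinset w N) (t : K) :
    charSum ψ (powerFinset w N) (c * t) = charSum ψ (powerFinset w N) t := by
  have hc0 : c ≠ 0 := fun h => zero_notMem_powerFinset (h ▸ hc)
  refine sum_nbij' (fun x => x * c) (fun x => x * c⁻¹) (fun x hx => mul_mem_powerFinset hx hc)
    (fun x hx => mul_mem_powerFinset hx (inv_mem_powerFinset hc)) ?_ ?_ ?_ <;> intro x _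
  · simp [hc0]
  · simp [hc0]
  · rw [mul_assoc]

lemma charSum_powerFinset_zpow (ψ : AddChar K ℂ) (s j : ℤ) :
    charSum ψ (powerFinset w N) ((w ^ (s + N * j) : Kˣ) : K)
      = charSum ψ (powerFinset w N) ((w ^ s : Kˣ) : K) := by
  rw [add_comm, zpow_add, Units.val_mul, charSum_powerFinset_mul _ (zpow_mem_powerFinset j)]

/-- Every Gauss period occurs at some `w ^ i` with `0 ≤ i < N`. -/
lemma exists_pow_charSum_powerFinset_eq (ψ : AddChar K ℂ) (hN : 0 < N) (s : ℤ) :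
    ∃ i < N, (∃ j : ℤ, s = i + N * j) ∧
      charSum ψ (powerFinset w N) ((w ^ s : Kˣ) : K)
        = charSum ψ (powerFinset w N) ((w ^ i : Kˣ) : K) := by
  have hN' : (0 : ℤ) < N := by exact_mod_cast hN
  obtain ⟨i, hi⟩ := Int.eq_ofNat_of_zero_le (Int.emod_nonneg s hN'.ne')
  have hs : s = i + N * (s / N) := by rw [← hi, Int.emod_add_mul_ediv]
  refine ⟨i, by have := Int.emod_lt_of_pos s hN'; omega, ⟨_, hs⟩, ?_⟩
  conv_lhs => rw [hs]
  rw [charSum_powerFinset_zpow, zpow_natCast]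

/-! ### Gauss periods and the intersection numbers of the trace hyperplane -/

variable {F : Type*} [Field F] [Fintype F] [Algebra F K]

open Classical in
/-- The elements of trace zero in the coset `w ^ i * ⟨w ^ N⟩`, which is closed under multiplication
by `Fˣ`, are `|F| - 1` times as many as the points of the hyperplane in its image in `Kˣ / Fˣ`. -/
lemma card_trace_eq_zero_powerFinset (hF : ∀ x : F, x ≠ 0 → algebraMap F K x ∈ powerFinset w N)
    (i : ℕ) :
    #{c ∈ powerFinset w N | Algebra.trace F K (c * (w ^ i : Kˣ)) = 0}
      = (Fintype.card F - 1) * hyperplaneCount F w N i := by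
  set T : Set (Kˣ ⧸ subfieldUnits F K) := singerHyperplane F K ∩
    ((QuotientGroup.mk' (subfieldUnits F K) w) ^ i •
      (classImage F w N : Set (Kˣ ⧸ subfieldUnits F K))) with hT
  have hHcard : Nat.card (subfieldUnits F K) = Fintype.card F - 1 := by
    rw [← Fintype.card_units, ← Nat.card_eq_fintype_card]
    exact (Nat.card_congr (MonoidHom.ofInjective
      (Units.map_injective (algebraMap F K).injective)).toEquiv).symm
  have hpre : Nat.card ((QuotientGroup.mk : Kˣ → Kˣ ⧸ subfieldUnits F K) ⁻¹' T)
      = (Fintype.card F - 1) * hyperplaneCount F w N i := by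
    rw [Nat.card_congr (QuotientGroup.preimageMkEquivSubgroupProdSet _ _), Nat.card_prod, hHcard,
      Nat.card_coe_set_eq, hyperplaneCount]
  have hmem : ∀ u : Kˣ, (u : Kˣ ⧸ subfieldUnits F K) ∈ T ↔
      Algebra.trace F K (u : K) = 0 ∧ ((u * (w ^ i)⁻¹ : Kˣ) : K) ∈ powerFinset w N := by
    intro u
    refine and_congr ?_ ?_
    · constructor
      · rintro ⟨x, hx, hxu⟩
        obtain ⟨a, ha⟩ := QuotientGroup.eq.1 hxu
        have hu : (u : K) = (a : F) • (x : K) := by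
          rw [Algebra.smul_def]
          have hux : u = x * Units.map (algebraMap F K : F →* K) a := by
            rw [ha, mul_inv_cancel_left]
          rw [hux]
          simp [mul_comm]
        have hx' : Algebra.trace F K (x : K) = 0 := hx
        rw [hu, map_smul, hx', smul_zero]
      · exact fun h => ⟨u, h, rfl⟩
    · rw [Set.mem_smul_set_iff_inv_smul_mem, mem_powerFinset]
      simp only [classImage, SetLike.mem_coe, Subgroup.mem_map, Subgroup.mem_zpowers_iff,
        smul_eq_mul]
      constructor
      · rintro ⟨_, ⟨j, rfl⟩, hj⟩
        have hj' : (((w ^ N) ^ j : Kˣ) : Kˣ ⧸ subfieldUnits F K)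
            = ((w ^ i)⁻¹ * u : Kˣ) := by simpa using hj
        obtain ⟨a, ha⟩ := QuotientGroup.eq.1 hj'
        have hmul := mul_mem_powerFinset (zpow_mem_powerFinset (w := w) (N := N) j) (hF a a.ne_zero)
        rw [← mem_powerFinset]
        convert hmul using 1
        have := congrArg (fun z : Kˣ => (((w ^ N) ^ j : Kˣ) : K) * z) ha
        rw [zpow_mul, zpow_natCast, mul_comm u]
        simp only [← Units.val_mul, mul_inv_cancel_left] at this
        rw [← this]
        simp
      · rintro ⟨j, hj⟩
        refine ⟨_, ⟨j, rfl⟩, ?_⟩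
        have hj' : u * (w ^ i)⁻¹ = (w ^ N) ^ j := by
          rw [Units.ext_iff, hj, zpow_mul, zpow_natCast]
        rw [← hj', mul_comm]
        simp
  rw [← hpre, ← Fintype.card_coe, ← Nat.card_eq_fintype_card]
  refine Nat.card_congr ⟨fun c => ⟨Units.mk0 c.1 (fun h => ?_) * w ^ i, ?_⟩,
    fun u => ⟨((u.1 * (w ^ i)⁻¹ : Kˣ) : K), ?_⟩, ?_, ?_⟩
  · exact zero_notMem_powerFinset (h ▸ (mem_filter.1 c.2).1)
  · rw [Set.mem_preimage, hmem]
    have := mem_filter.1 c.2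
    exact ⟨by simpa using this.2, by simpa using this.1⟩
  · have := (hmem u.1).1 u.2
    exact mem_filter.2 ⟨this.2, by simpa using this.1⟩
  · intro c
    ext
    simp
  · intro u
    ext
    simp

/-- Averaging over the scalars `Fˣ` expresses a Gauss period through the number of elements of
trace zero, hence through an intersection number of the hyperplane. -/
lemma charSum_powerFinset_eq_hyperplaneCount {ψ : AddChar F ℂ} (hψ : ψ.IsPrimitive)
    (hF : ∀ x : F, x ≠ 0 → algebraMap F K x ∈ powerFinset w N) (i : ℕ) :
    (Fintype.card F - 1 : ℂ) * charSum (traceChar K ψ) (powerFinset w N) ((w ^ i : Kˣ) : K)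
      = Fintype.card F * ((Fintype.card F - 1) * hyperplaneCount F w N i)
        - #(powerFinset w N) := by
  classical
  set t : K := ((w ^ i : Kˣ) : K)
  have h1 : ∑ a : F, charSum (traceChar K ψ) (powerFinset w N) (algebraMap F K a * t)
      = #(powerFinset w N)
        + (Fintype.card F - 1) * charSum (traceChar K ψ) (powerFinset w N) t := by
    rw [← add_sum_erase _ _ (mem_univ (0 : F)), map_zero, zero_mul, charSum_zero,
      sum_congr rfl fun a ha => charSum_powerFinset_mul _ (hF a (ne_of_mem_erase ha)) t,
      sum_const, card_erase_of_mem (mem_univ _), card_univ, nsmul_eq_mul,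
      Nat.cast_sub Fintype.card_pos, Nat.cast_one]
  have h2 : ∑ a : F, charSum (traceChar K ψ) (powerFinset w N) (algebraMap F K a * t)
      = Fintype.card F * #{c ∈ powerFinset w N | Algebra.trace F K (c * t) = 0} := by
    simp only [charSum, traceChar_apply]
    rw [sum_comm]
    have : ∀ c : K, ∑ a : F, ψ (Algebra.trace F K (c * (algebraMap F K a * t)))
        = if Algebra.trace F K (c * t) = 0 then (Fintype.card F : ℂ) else 0 := fun c => by
      have e : ∀ a : F, Algebra.trace F K (c * (algebraMap F K a * t))
          = a * Algebra.trace F K (c * t) := fun a => by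
        rw [mul_left_comm, ← Algebra.smul_def, map_smul, smul_eq_mul]
      simp_rw [e, AddChar.sum_mulShift _ hψ]
      split_ifs <;> simp
    rw [sum_congr rfl fun c _ => this c, ← sum_filter, sum_const, nsmul_eq_mul, mul_comm]
  rw [card_trace_eq_zero_powerFinset hF] at h2
  rw [Nat.cast_mul, Nat.cast_sub Fintype.card_pos, Nat.cast_one] at h2
  linear_combination h2 - h1

lemma charSum_powerFinset_sub {ψ : AddChar F ℂ} (hψ : ψ.IsPrimitive)
    (hF : ∀ x : F, x ≠ 0 → algebraMap F K x ∈ powerFinset w N) (i : ℕ) :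
    charSum (traceChar K ψ) (powerFinset w N) ((w ^ i : Kˣ) : K)
      = charSum (traceChar K ψ) (powerFinset w N) 1 + Fintype.card F * (countDiff F w N i : ℂ) := by
  have hi := charSum_powerFinset_eq_hyperplaneCount hψ hF i
  have h0 := charSum_powerFinset_eq_hyperplaneCount hψ hF 0
  rw [pow_zero, Units.val_one] at h0
  have hq : (Fintype.card F - 1 : ℂ) ≠ 0 := by
    rw [sub_ne_zero]
    exact_mod_cast (Fintype.one_lt_card (α := F)).ne'
  apply mul_left_cancel₀ hq
  rw [countDiff]
  push_cast
  linear_combination hi - h0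

end Cyclotomic

/-! ### Lifting the subdifference set to the quadratic extension -/

section Lift

lemma norm_eq_of_pow_eq {K L : Type*} [Field K] [Fintype K] [Field L] [Fintype L] [Algebra K L]
    (hL : Module.finrank K L = 2) {γ : Lˣ} {ω : Kˣ}
    (hω : algebraMap K L (ω : K) = (γ : L) ^ (Fintype.card K + 1)) :
    Units.map (Algebra.norm K (S := L)) γ = ω := by
  ext
  apply (algebraMap K L).injective
  rw [Units.coe_map, hω, algebraMap_norm_of_finrank_eq_two hL, pow_succ']

lemma mem_zpowers_of_norm_eq {K L : Type*} [Field K] [Field L] [Finite L] [Algebra K L] {γ : Lˣ}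
    {ω : Kˣ} (hω : Units.map (Algebra.norm K (S := L)) γ = ω)
    (hγ : ∀ x : Lˣ, x ∈ Subgroup.zpowers γ) (x : Kˣ) : x ∈ Subgroup.zpowers ω := by
  obtain ⟨y, rfl⟩ := FiniteField.unitsMap_norm_surjective K L x
  obtain ⟨j, rfl⟩ := Subgroup.mem_zpowers_iff.1 (hγ y)
  exact Subgroup.mem_zpowers_iff.2 ⟨j, by rw [map_zpow, hω]⟩

lemma addCayley_eq_top {G : Type*} [AddCommGroup G] {S : Set G} (h : IsConnectionSet S)
    (hS : ∀ x ≠ 0, x ∈ S) : SimpleGraph.addCayley S = ⊤ := by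
  ext u v
  rw [addCayley_adj_iff h, SimpleGraph.top_adj]
  refine ⟨?_, fun huv => hS _ (sub_ne_zero.2 huv.symm)⟩
  rintro hS rfl
  exact h.1 (by simpa using hS)

/-- In a finite cyclic group generated by `w`, whose order is a multiple of `N`, a set of elements
described by the residue modulo `N` of their exponent has `|G| / N` elements for each residue. -/
lemma card_mul_eq_of_pow_mem_iff {K : Type*} [Field K] [Fintype K] {w : Kˣ} {N : ℕ}
    (hw : ∀ x : Kˣ, x ∈ Subgroup.zpowers w) (hN : N ∣ Fintype.card K - 1) (hN0 : 0 < N)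
    {D : Finset K} (hD0 : 0 ∉ D) {I : Finset ℕ} (hI : ∀ i ∈ I, i < N)
    (hD : ∀ i < N, ∀ j : ℕ, ((w ^ (i + N * j) : Kˣ) : K) ∈ D ↔ i ∈ I) :
    #D * N = (Fintype.card K - 1) * #I := by
  obtain ⟨M, hM⟩ := hN
  have hord : orderOf w = N * M := by
    rw [orderOf_eq_card_of_forall_mem_zpowers hw, Nat.card_units,
      Nat.card_eq_fintype_card, hM]
  have hlt : ∀ {i j}, i < N → j < M → i + N * j < N * M := fun {i j} hi hj => by
    calc i + N * j < N + N * j := by omega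
      _ = N * (j + 1) := by ring
      _ ≤ N * M := Nat.mul_le_mul_left _ hj
  have hcard : #(I ×ˢ range M) = #D := by
    refine card_bij (fun p _ => ((w ^ (p.1 + N * p.2) : Kˣ) : K)) ?_ ?_ ?_
    · rintro ⟨i, j⟩ hp
      have := mem_product.1 hp
      exact (hD i (hI i this.1) j).2 this.1
    · rintro ⟨i, j⟩ hp ⟨i', j'⟩ hp' h
      have hi := mem_product.1 hp
      have hi' := mem_product.1 hp'
      simp only [mem_range] at hi hi'
      have h' : i + N * j = i' + N * j' := by
        refine pow_injOn_Iio_orderOf ?_ ?_ (Units.ext h)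
        · rw [hord]
          exact hlt (hI i hi.1) hi.2
        · rw [hord]
          exact hlt (hI i' hi'.1) hi'.2
      have e1 : i = i' := by
        have := congrArg (· % N) h'
        simpa [Nat.add_mul_mod_self_left, Nat.mod_eq_of_lt (hI i hi.1),
          Nat.mod_eq_of_lt (hI i' hi'.1)] using this
      subst e1
      have e2 : j = j' := Nat.eq_of_mul_eq_mul_left hN0 (by omega)
      rw [e2]
    · intro t ht
      have ht0 : t ≠ 0 := fun h => hD0 (h ▸ ht)
      obtain ⟨s, hs⟩ := (mem_powers_iff_mem_zpowers (x := w)).2 (hw (Units.mk0 t ht0))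
      have hts : ((w ^ (s % (N * M)) : Kˣ) : K) = t := by
        rw [← hord, pow_mod_orderOf]
        exact congrArg Units.val hs
      have hpos : 0 < N * M := hord ▸ orderOf_pos w
      set s' := s % (N * M)
      have hs' : s' < N * M := Nat.mod_lt _ hpos
      have hdec : s' % N + N * (s' / N) = s' := Nat.mod_add_div _ _
      refine ⟨(s' % N, s' / N), ?_, ?_⟩
      · rw [mem_product, mem_range]
        refine ⟨?_, Nat.div_lt_of_lt_mul hs'⟩
        rw [← hD _ (Nat.mod_lt _ hN0) (s' / N), hdec, hts]
        exact ht
      · simp only [hdec, hts]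
  rw [← hcard, card_product, card_range, hM]
  ring

end Lift

theorem proposition3p1
    {F K L : Type*} [Field F] [Fintype F] [Field K] [Fintype K] [Field L] [Fintype L]
    [Algebra F K] [Algebra K L]
    (q m N : ℕ) (hq : Fintype.card F = q) (hm : 2 ≤ m)
    (hK : Module.finrank F K = m) (hL : Module.finrank K L = 2)
    -- a primitive element of the big field, and the primitive element of the middle one below it
    (γ : Lˣ) (hγ : ∀ x : Lˣ, x ∈ Subgroup.zpowers γ)
    (ω : Kˣ) (hω : algebraMap K L (ω : K) = (γ : L) ^ (q ^ m + 1))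
    -- the class of index `N` in `Kˣ` contains all nonzero elements of `F`
    (hN : N ∣ q ^ m - 1)
    (hF : ∀ x : F, x ≠ 0 → algebraMap F K x ∈ cyclotomicClass ω N 0)
    -- the cyclotomic graph is strongly regular
    (hsrg : ∃ v k l μ : ℕ,
      IsStronglyRegular (SimpleGraph.addCayley (cyclotomicClass ω N 0)) v k l μ) :
    ∃ δ : ℤ, δ ≠ 0 ∧ {d : ℤ | ∃ i < N, countDiff F ω N i = d} = {0, δ} ∧
      IsConnectionSet (cyclotomicUnion γ N (subdifferenceSet F ω N δ)) ∧
      ∃ r : ℕ,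
        (r : ℚ) = ((q : ℚ) ^ m - 1) * ((subdifferenceSet F ω N δ).card : ℚ) / (N : ℚ) ∧
        IsNegativeLatinSquareSRG
          (SimpleGraph.addCayley (cyclotomicUnion γ N (subdifferenceSet F ω N δ)))
          (q ^ m) r := by
  classical
  have hcard : Fintype.card K = q ^ m := by
    rw [Module.card_eq_pow_finrank (K := F), hK, hq]
  have hKone : 1 < Fintype.card K := Fintype.one_lt_card
  rw [← hcard] at hN hω ⊢
  have hN0 : 0 < N := Nat.pos_of_dvd_of_pos hN (by omega)
  have hnorm := norm_eq_of_pow_eq hL hω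
  have hgen := mem_zpowers_of_norm_eq hnorm hγ
  have hF' : ∀ x : F, x ≠ 0 → algebraMap F K x ∈ powerFinset ω N := fun x hx => by
    rw [← mem_coe, coe_powerFinset]
    exact hF x hx
  have hneg1 : (-1 : K) ∈ powerFinset ω N := by
    simpa using hF' (-1) (neg_ne_zero.2 one_ne_zero)
  have hconn := isConnectionSet_powerFinset hneg1
  obtain ⟨ψ, hψ1⟩ := AddChar.exists_apply_ne_zero.2 (one_ne_zero (α := F))
  have hψ : ψ.IsPrimitive := AddChar.IsPrimitive.of_ne_one (AddChar.ne_one_iff.2 ⟨1, hψ1⟩)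
  have hχ := isPrimitive_traceChar (L := K) hψ
  set χ := traceChar K ψ
  set η : K → ℂ := charSum χ (powerFinset ω N) with hη
  have hcount : ∀ i, η ((ω ^ i : Kˣ) : K) = η 1 + Fintype.card F * (countDiff F ω N i : ℂ) :=
    charSum_powerFinset_sub hψ hF'
  have hqne : (Fintype.card F : ℂ) ≠ 0 := by exact_mod_cast Fintype.card_ne_zero
  obtain ⟨v, k, l, μ, hsr⟩ := hsrg
  rw [← coe_powerFinset] at hsr
  -- a constant spectrum would force the graph to be complete
  obtain ⟨i₀, hi₀N, hi₀⟩ : ∃ i < N, countDiff F ω N i ≠ 0 := by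
    by_contra! hall
    refine hsr.2.1 (addCayley_eq_top hconn fun x hx => ?_)
    refine (mem_iff_mem_of_charSum_eq hχ _ (η 1) (fun y hy => ?_) one_ne_zero hx).1
      one_mem_powerFinset
    obtain ⟨s, hs⟩ := Subgroup.mem_zpowers_iff.1 (hgen (Units.mk0 y hy))
    obtain ⟨i, hi, -, hyi⟩ := exists_pow_charSum_powerFinset_eq χ hN0 (w := ω) s
    rw [hs, Units.val_mk0] at hyi
    rw [hyi]
    simpa [hall i hi] using hcount i
  set δ := countDiff F ω N i₀ with hδ
  -- `η 1`, `η (ω ^ i₀)` and `η (ω ^ i)` are roots of the same quadratic polynomial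
  have htwo : ∀ i, countDiff F ω N i ≠ 0 → countDiff F ω N i = δ := fun i hi => by
    have h0 := charSum_sq_of_isStronglyRegular hχ hconn hsr one_ne_zero
    have h1 := charSum_sq_of_isStronglyRegular hχ hconn hsr (ω ^ i₀ : Kˣ).ne_zero
    have h2 := charSum_sq_of_isStronglyRegular hχ hconn hsr (ω ^ i : Kˣ).ne_zero
    change η 1 ^ 2 = _ + _ * η 1 at h0
    change η _ ^ 2 = _ + _ * η _ at h1 h2
    rw [hcount] at h1 h2
    have hi' : (countDiff F ω N i : ℂ) ≠ 0 := by exact_mod_cast hi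
    have hi₀' : (countDiff F ω N i₀ : ℂ) ≠ 0 := by exact_mod_cast hi₀
    have e1 : 2 * η 1 + Fintype.card F * (countDiff F ω N i₀ : ℂ) - (l - μ) = 0 := by
      apply mul_left_cancel₀ (mul_ne_zero hqne hi₀')
      linear_combination h1 - h0
    have e2 : 2 * η 1 + Fintype.card F * (countDiff F ω N i : ℂ) - (l - μ) = 0 := by
      apply mul_left_cancel₀ (mul_ne_zero hqne hi')
      linear_combination h2 - h0
    have e3 : (countDiff F ω N i : ℂ) = countDiff F ω N i₀ := by
      apply mul_left_cancel₀ hqne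
      linear_combination e2 - e1
    exact_mod_cast e3
  set I := subdifferenceSet F ω N δ with hI
  have hmemI : ∀ i, i ∈ I ↔ i < N ∧ η ((ω ^ i : Kˣ) : K) ≠ η 1 := fun i => by
    rw [hI, subdifferenceSet, mem_filter, mem_range, hcount]
    simp only [ne_eq, add_eq_left, mul_eq_zero, hqne, Int.cast_eq_zero, false_or]
    exact and_congr_right fun _ => ⟨fun h => h ▸ hi₀, htwo i⟩
  -- the dual of the connection set `⟨ω ^ N⟩`
  set D : Finset K := {t | t ≠ 0 ∧ η t ≠ η 1} with hD
  have hmemD : ∀ t, t ∈ D ↔ t ≠ 0 ∧ η t ≠ η 1 := fun t => by simp [hD]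
  have hD0 : (0 : K) ∉ D := fun h => ((hmemD 0).1 h).1 rfl
  have hηD : ∀ t ∈ D, η t = η 1 + Fintype.card F * (δ : ℂ) := fun t ht => by
    obtain ⟨ht0, ht1⟩ := (hmemD t).1 ht
    obtain ⟨s, hs⟩ := Subgroup.mem_zpowers_iff.1 (hgen (Units.mk0 t ht0))
    obtain ⟨i, hi, -, hti⟩ := exists_pow_charSum_powerFinset_eq χ hN0 (w := ω) s
    rw [hs, Units.val_mk0] at hti
    change η t = η _ at hti
    rw [hti, hcount] at ht1 ⊢
    rw [htwo i fun h => ht1 (by simp [h])]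
  have hlift : cyclotomicUnion γ N I = (normPreimage L D : Set L) := by
    have hnormpow : ∀ s : ℤ, Algebra.norm K ((γ ^ s : Lˣ) : L) = ((ω ^ s : Kˣ) : K) := fun s => by
      rw [← hnorm, ← map_zpow, Units.coe_map]
    ext x
    simp only [cyclotomicUnion, Set.mem_iUnion, exists_prop, mem_coe, mem_normPreimage,
      mem_cyclotomicClass]
    constructor
    · rintro ⟨i, hi, j, rfl⟩
      rw [hnormpow, hmemD]
      refine ⟨Units.ne_zero _, ?_⟩
      rw [hη, charSum_powerFinset_zpow, zpow_natCast]
      exact ((hmemI i).1 hi).2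
    · intro hx
      have hx0 : x ≠ 0 := by
        rintro rfl
        exact hD0 (by simpa using hx)
      obtain ⟨s, hs⟩ := Subgroup.mem_zpowers_iff.1 (hγ (Units.mk0 x hx0))
      have hxs : x = ((γ ^ s : Lˣ) : L) := by rw [hs, Units.val_mk0]
      obtain ⟨i, hi, ⟨j, hj⟩, hsi⟩ := exists_pow_charSum_powerFinset_eq χ hN0 (w := ω) s
      rw [hxs, hnormpow, hmemD] at hx
      refine ⟨i, (hmemI i).2 ⟨hi, ?_⟩, j, by rw [hxs, hj]⟩
      exact fun h => hx.2 (hsi.trans h)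
  have hDcard : #D * N = (Fintype.card K - 1) * #I := by
    refine card_mul_eq_of_pow_mem_iff hgen hN hN0 hD0 (fun i hi => ((hmemI i).1 hi).1)
      fun i hi j => ?_
    have := charSum_powerFinset_zpow (w := ω) (N := N) χ i j
    rw [zpow_natCast, ← Nat.cast_mul, ← Nat.cast_add, zpow_natCast] at this
    rw [hmemD, hmemI, hη, this]
    simp [hi]
  refine ⟨δ, hi₀, ?_, ?_, #D, ?_, ?_⟩
  · ext d
    simp only [Set.mem_ofPred_eq, Set.mem_insert_iff, Set.mem_singleton_iff]
    constructor
    · rintro ⟨i, -, rfl⟩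
      exact or_iff_not_imp_left.2 (htwo i)
    · rintro (rfl | rfl)
      · exact ⟨0, hN0, by simp [countDiff]⟩
      · exact ⟨i₀, hi₀N, rfl⟩
  · rw [hlift]
    exact isConnectionSet_normPreimage hL hD0
  · rw [eq_div_iff (by exact_mod_cast hN0.ne'), ← Nat.cast_pow, ← hcard, ← Nat.cast_one,
      ← Nat.cast_sub hKone.le]
    exact_mod_cast hDcard
  · rw [hlift]
    refine isNegativeLatinSquareSRG_normPreimage hχ hL zero_notMem_powerFinset
      (fun c hc => by simpa using mul_mem_powerFinset hneg1 hc)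
      (fun c hc => inv_mem_powerFinset hc) hD0 (κ := Fintype.card F * (δ : ℂ)) ?_ hηD ?_ ?_ ?_
    · exact mul_ne_zero hqne (by exact_mod_cast hi₀)
    · intro t ht htD
      by_contra h
      exact htD ((hmemD t).2 ⟨ht, h⟩)
    · refine ⟨((ω ^ i₀ : Kˣ) : K), (hmemD _).2 ⟨Units.ne_zero _, ?_⟩⟩
      exact ((hmemI i₀).1 (by simp [hI, subdifferenceSet, hi₀N, ← hδ])).2
    · exact fun h => ((hmemD 1).1 h).2 rfl
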